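/- Let $d,L\ge 1$ and $m\ge 0$ be integers and let $\phi^{(1)},\dots,\phi^{(L)}$ be real polynomials. For each width $n\ge 1$ consider the fully connected network $f_\theta:\mathbb{R}^d\to\mathbb{R}$ with $L$ hidden layers of width $n$ and parameters $\theta=(U,W^{(2)},\dots,W^{(L)},V)$, where $U\in\mathbb{R}^{n\times d}$, $W^{(\ell)}\in\mathbb{R}^{n\times n}$, $V\in\mathbb{R}^n$, given by $$x^{(1)}=\phi^{(1)}\big(d^{-1/2}Ux\big),\qquad x^{(\ell)}=\phi^{(\ell)}\big(n^{-1/2}W^{(\ell)}x^{(\ell-1)}\big)\ (2\le \ell\le L),\qquad f_\theta(x)=n^{-1/2}V^{T}x^{(L)},$$ with the polynomials applied entrywise, and let all entries of $\theta$ be i.i.d. $\mathcal N(0,1)$. A correlation function with $m$ derivative tensors is $$C_n(x_1,\dots,x_m)=\sum_{\mu_1,\dots,\mu_q}\mathbb{E}_\theta\Big[\prod_{K=1}^m \frac{\partial^{k_K}f_\theta(x_K)}{\partial\theta^{\mu_{a(K,1)}}\cdots\partial\theta^{\mu_{a(K,k_K)}}}\Big],$$ where $k_1,\dots,k_m\ge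 0$ are the ranks of the tensors, each summation index $\mu_1,\dots,\mu_q$ runs over all parameters, and the assignment $a$ of summation indices to tensor indices uses each of $1,\dots,q$ exactly twice (possibly twice in the same tensor). The ranks and the assignment $a$ do not depend on $n$. Its cluster graph has vertices $1,\dots,m$, with distinct $I,J$ adjacent if and only if some index of the $I$-th tensor is summed together with some index of the $J$-th tensor. Let $n_e$ and $n_o$ be the numbers of connected components of this graph with an even and an odd number of vertices, respectively. Then all the expectations above are finite (the integrands are integrable), and for all fixed $x_1,\dots,x_m\in\mathbb{R}^d$ $$C_n(x_1,\dots,x_m)=\mathcal{O}\big(n^{\,n_e+(n_o-m)/2}\big)\qquad (n\to\infty).$$ -/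

import Mathlib

open MeasureTheory ProbabilityTheory Filter Asymptotics

/-- Indices of the scalar parameters of a fully connected network with input dimension `d` and
`L` hidden layers of width `n`: the entries of `U ∈ ℝ^{n × d}`, of the `L - 1` matrices
`W^{(2)}, …, W^{(L)} ∈ ℝ^{n × n}` (`W ℓ i j` is the entry `(i, j)` of `W^{(ℓ + 2)}`),
and of `V ∈ ℝ^n`. -/
inductive Param (d L n : ℕ) : Type
  | U (i : Fin n) (α : Fin d)
  | W (ℓ : Fin (L - 1)) (i j : Fin n)
  | V (i : Fin n)
  deriving DecidableEq, Fintype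

/-- The post-activations. `postAct φ θ x ℓ _` is the vector `x^{(ℓ + 1)}`, and `φ ℓ` is the
polynomial non-linearity `φ^{(ℓ + 1)}`. -/
noncomputable def postAct {d L n : ℕ} (φ : Fin L → Polynomial ℝ) (θ : Param d L n → ℝ)
    (x : Fin d → ℝ) : (ℓ : ℕ) → ℓ < L → Fin n → ℝ
  | 0, h => fun i =>
      (φ ⟨0, h⟩).eval ((√(d : ℝ))⁻¹ * ∑ α, θ (.U i α) * x α)
  | ℓ + 1, h => fun i =>
      (φ ⟨ℓ + 1, h⟩).eval
        ((√(n : ℝ))⁻¹ *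
          ∑ j, θ (.W ⟨ℓ, by omega⟩ i j) * postAct φ θ x ℓ (Nat.lt_of_succ_lt h) j)

/-- The network function `f_θ(x) = n^{-1/2} Vᵀ x^{(L)}`. -/
noncomputable def network {d L n : ℕ} (hL : 0 < L) (φ : Fin L → Polynomial ℝ)
    (x : Fin d → ℝ) (θ : Param d L n → ℝ) : ℝ :=
  (√(n : ℝ))⁻¹ * ∑ i, θ (.V i) * postAct φ θ x (L - 1) (Nat.sub_lt hL Nat.one_pos) i

/-- The law of the parameters at initialization: i.i.d. standard normal. -/
noncomputable def initLaw (d L n : ℕ) : Measure (Param d L n → ℝ) :=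
  Measure.pi fun _ => gaussianReal 0 1

/-- The entry `∂^k g / ∂θ^{μ_1} ⋯ ∂θ^{μ_k}` at `θ` of the rank-`k` derivative tensor of `g`. -/
noncomputable def derivTensor {ι : Type} [Fintype ι] [DecidableEq ι] (g : (ι → ℝ) → ℝ) (k : ℕ)
    (θ : ι → ℝ) (μ : Fin k → ι) : ℝ :=
  iteratedFDeriv ℝ k g θ fun j => Pi.single (μ j) 1

/-- The index structure of a correlation function with `m` derivative tensors: the `K`-th tensor
has rank `rank K`, its `j`-th index is the summation index number `label ⟨K, j⟩`, and every
summation index occurs exactly twice. Both occurrences may lie in the same tensor. -/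
structure IndexStructure (m : ℕ) where
  rank : Fin m → ℕ
  numPairs : ℕ
  label : (Σ K : Fin m, Fin (rank K)) → Fin numPairs
  pairs : ∀ a, (Finset.univ.filter fun s => label s = a).card = 2

namespace IndexStructure

variable {m : ℕ} (S : IndexStructure m)

/-- Two different derivative tensors are adjacent in the cluster graph when some index of one is
summed together with some index of the other. -/
def clusterGraph : SimpleGraph (Fin m) where
  Adj I J := I ≠ J ∧ ∃ i j, S.label ⟨I, i⟩ = S.label ⟨J, j⟩
  symm := ⟨fun _ _ h => ⟨h.1.symm, h.2.choose_spec.choose, h.2.choose,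
    h.2.choose_spec.choose_spec.symm⟩⟩
  loopless := ⟨fun _ h => h.1 rfl⟩

/-- The number of connected components of the cluster graph with an even number of vertices. -/
noncomputable def numEven : ℕ :=
  {c : S.clusterGraph.ConnectedComponent | Even c.supp.ncard}.ncard

/-- The number of connected components of the cluster graph with an odd number of vertices. -/
noncomputable def numOdd : ℕ :=
  {c : S.clusterGraph.ConnectedComponent | Odd c.supp.ncard}.ncard

/-- The product of the `m` derivative tensors of the network function, for given values `μ` of the
summation indices, as a function of the parameters. -/
noncomputable def tensorProd {d L n : ℕ} (hL : 0 < L) (φ : Fin L → Polynomial ℝ)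
    (x : Fin m → Fin d → ℝ) (μ : Fin S.numPairs → Param d L n) (θ : Param d L n → ℝ) : ℝ :=
  ∏ K, derivTensor (network hL φ (x K)) (S.rank K) θ fun j => μ (S.label ⟨K, j⟩)

/-- The correlation function `C(x_1, …, x_m)` of the network of width `n`. -/
noncomputable def correlation {d L : ℕ} (hL : 0 < L) (φ : Fin L → Polynomial ℝ)
    (x : Fin m → Fin d → ℝ) (n : ℕ) : ℝ :=
  ∑ μ : Fin S.numPairs → Param d L n, ∫ θ, S.tensorProd hL φ x μ θ ∂(initLaw d L n)

end IndexStructure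

/-! ### Derivative tensors of polynomial functions -/

section Derivatives

variable {ι : Type}

/-! The network function is a polynomial in the parameters. Expanding it gives a linear combination,
with coefficients independent of `n`, of sums over labelled trees (`RootedTerm.exists_network_eq`).
A tree with `v` non-root vertices has `v` edges, each an entry of some `W`, one entry of `V` at the
root, entries of `U` as decorations, and prefactor `n^{-(v+1)/2}`. The sum runs over all assignments
of neurons to vertices. By multilinearity it suffices to bound the correlation of `m` fixed trees
with `v` non-root vertices in total.

For a fixed assignment, a summation index contributes only if it is a parameter present in the
monomials. The sum over `μ` is therefore bounded independently of `n`
(`abs_sum_monomialExpectation_le`), and only the nonvanishing assignments need counting. Odd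
Gaussian moments vanish and each summation index is differentiated twice, so every parameter has
even total exponent; adjacent tensors share a parameter.

Consider the graph whose vertices are the neurons used and whose edges are the distinct entries of
`W` used. Each edge has multiplicity at least 2, so there are at most `v/2` edges. Each tree lies in
one component, as does each cluster. The entries of `V` at the roots pair up, so every component
contains an even number of trees, hence an even cluster or at least two odd ones. There are thus at
most `n_e + n_o/2` components and at most `v/2 + n_e + n_o/2` neurons (`two_mul_ncard_range_le`).
Multiplying the resulting count of assignments by the prefactor `n^{-(v+m)/2}` cancels `v` and
leaves the claimed exponent. -/

theorem hasFDerivAt_mvPolynomial_eval [Fintype ι] (P : MvPolynomial ι ℝ) (θ : ι → ℝ) :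
    HasFDerivAt (fun θ : ι → ℝ => MvPolynomial.eval θ P)
      (∑ i, MvPolynomial.eval θ (MvPolynomial.pderiv i P) •
        (ContinuousLinearMap.proj i : (ι → ℝ) →L[ℝ] ℝ)) θ := by
  classical
  induction P using MvPolynomial.induction_on with
  | C a => simpa using hasFDerivAt_const a θ
  | add p q hp hq =>
    simpa [add_smul, Finset.sum_add_distrib] using hp.fun_add hq
  | mul_X p j hp =>
    have h := hp.mul (ContinuousLinearMap.proj (R := ℝ) (φ := fun _ : ι => ℝ) j).hasFDerivAt (x := θ)
    convert! h using 1
    · ext θ'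
      simp
    · ext v
      simp [Derivation.leibniz, MvPolynomial.pderiv_X, Pi.single_apply, Finset.sum_add_distrib,
        add_mul, Finset.mul_sum, mul_assoc, apply_ite]

theorem contDiff_mvPolynomial_eval [Fintype ι] (P : MvPolynomial ι ℝ) {k : WithTop ℕ∞} :
    ContDiff ℝ k fun θ : ι → ℝ => MvPolynomial.eval θ P := by
  induction P using MvPolynomial.induction_on with
  | C a => simpa using contDiff_const
  | add p q hp hq => simpa using hp.add hq
  | mul_X p j hp => simpa using hp.mul (contDiff_apply ℝ ℝ j)

/-- The iterated partial derivative `∂^k / ∂X_{μ 0} ⋯ ∂X_{μ (k - 1)}` of polynomials. -/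
noncomputable def iterPDeriv : (k : ℕ) → (Fin k → ι) → MvPolynomial ι ℝ →ₗ[ℝ] MvPolynomial ι ℝ
  | 0, _ => LinearMap.id
  | k + 1, μ => (MvPolynomial.pderiv (μ 0)).toLinearMap ∘ₗ iterPDeriv k (fun j => μ j.succ)

theorem derivTensor_mvPolynomial_eval [Fintype ι] [DecidableEq ι] (P : MvPolynomial ι ℝ) (k : ℕ) (θ : ι → ℝ) (μ : Fin k → ι) :
    derivTensor (fun θ : ι → ℝ => MvPolynomial.eval θ P) k θ μ =
      MvPolynomial.eval θ (iterPDeriv k μ P) := by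
  induction k generalizing θ with
  | zero => simp [derivTensor, iterPDeriv]
  | succ k ih =>
    have hd : DifferentiableAt ℝ
        (iteratedFDeriv ℝ k fun θ : ι → ℝ => MvPolynomial.eval θ P) θ :=
      (contDiff_mvPolynomial_eval P (k := ⊤)).differentiable_iteratedFDeriv
        (by exact_mod_cast WithTop.coe_lt_top _) θ
    -- The outermost derivative is in direction `μ 0`, matching the recursion of `iterPDeriv`;
    -- evaluation at the remaining fixed directions commutes with it.
    have h1 : derivTensor (fun θ : ι → ℝ => MvPolynomial.eval θ P) (k + 1) θ μ =
        fderiv ℝ (fun θ' => derivTensor (fun θ : ι → ℝ => MvPolynomial.eval θ P) k θ'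
          fun j => μ j.succ) θ (Pi.single (μ 0) 1) := by
      unfold derivTensor
      rw [iteratedFDeriv_succ_apply_left, fderiv_continuousMultilinear_apply_const_apply hd]
      rfl
    rw [h1]
    simp_rw [ih]
    rw [(hasFDerivAt_mvPolynomial_eval _ θ).fderiv]
    simp [iterPDeriv, Pi.single_apply]

/-- An iterated partial derivative of a monomial is again a monomial, whose exponents have dropped
by the multiplicities of the derivatives. -/
theorem iterPDeriv_monomial (s : ι →₀ ℕ) (k : ℕ) (μ : Fin k → ι) :
    ∃ c : ℕ, c ≤ s.degree ^ k ∧ (c ≠ 0 → ∑ j, Finsupp.single (μ j) 1 ≤ s) ∧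
      iterPDeriv k μ (MvPolynomial.monomial s 1) =
        MvPolynomial.monomial (s - ∑ j, Finsupp.single (μ j) 1) (c : ℝ) := by
  classical
  induction k with
  | zero => exact ⟨1, by simp [iterPDeriv]⟩
  | succ k ih =>
    obtain ⟨c, hc, hs, h⟩ := ih fun j => μ j.succ
    set t := ∑ j : Fin k, Finsupp.single (μ j.succ) 1 with ht
    -- The new factor is the exponent of `μ 0` still left. It vanishes exactly when no such factor
    -- remains, so truncated subtraction only matters where the coefficient is zero.
    refine ⟨c * (s - t) (μ 0), ?_, ?_, ?_⟩
    · rw [pow_succ]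
      refine Nat.mul_le_mul hc ?_
      exact (Finsupp.le_degree (μ 0) (s - t)).trans (Finsupp.degree_mono tsub_le_self)
    · intro hne
      obtain ⟨hc0, hst⟩ := mul_ne_zero_iff.1 hne
      rw [Fin.sum_univ_succ, ← ht]
      intro i
      have h1 := hs hc0 i
      simp only [Finsupp.coe_add, Pi.add_apply, Finsupp.single_apply, Finsupp.coe_tsub,
        Pi.sub_apply] at hst ⊢
      split_ifs with hi
      · subst hi; omega
      · omega
    · simp only [iterPDeriv, LinearMap.comp_apply, h, Derivation.coeFn_coe,
        MvPolynomial.pderiv_monomial]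
      rw [Fin.sum_univ_succ, ← ht, tsub_tsub, add_comm t]
      push_cast
      rfl

end Derivatives

/-! ### Gaussian moments -/

theorem integrable_pow_gaussianReal (k : ℕ) :
    Integrable (fun x : ℝ => x ^ k) (gaussianReal 0 1) := by
  have h := (memLp_id_gaussianReal (μ := 0) (v := 1) (k : NNReal)).integrable_norm_pow'
  exact (integrable_norm_iff (by fun_prop)).1 (by simpa using h)

/-- The standard Gaussian is invariant under `x ↦ -x`. -/
theorem integral_odd_pow_gaussianReal {k : ℕ} (hk : Odd k) :
    ∫ x : ℝ, x ^ k ∂(gaussianReal 0 1) = 0 := by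
  have h : ∫ x : ℝ, x ^ k ∂((gaussianReal 0 1).map fun x => -x) =
      ∫ x : ℝ, (-x) ^ k ∂(gaussianReal 0 1) :=
    integral_map (by fun_prop) (by fun_prop)
  rw [gaussianReal_map_neg, neg_zero] at h
  simp only [hk.neg_pow, integral_neg] at h
  linarith

section Moments

variable {ι : Type} [Fintype ι]

theorem eval_monomial_eq_prod (s : ι →₀ ℕ) (c : ℝ) (θ : ι → ℝ) :
    MvPolynomial.eval θ (MvPolynomial.monomial s c) = c * ∏ i, θ i ^ s i := by
  rw [MvPolynomial.eval_monomial, Finsupp.prod_fintype _ _ (by simp)]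

theorem integrable_mvPolynomial_eval (P : MvPolynomial ι ℝ) :
    Integrable (fun θ : ι → ℝ => MvPolynomial.eval θ P)
      (Measure.pi fun _ => gaussianReal 0 1) := by
  induction P using MvPolynomial.induction_on' with
  | monomial s c =>
    simp_rw [eval_monomial_eq_prod]
    exact (Integrable.fintype_prod (f := fun i (y : ℝ) => y ^ s i)
      fun i => integrable_pow_gaussianReal (s i)).const_mul c
  | add p q hp hq => simpa only [map_add] using hp.fun_add hq

theorem integral_monomial (s : ι →₀ ℕ) :
    ∫ θ : ι → ℝ, MvPolynomial.eval θ (MvPolynomial.monomial s (1 : ℝ))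
      ∂(Measure.pi fun _ => gaussianReal 0 1) =
      ∏ i, ∫ y : ℝ, y ^ s i ∂(gaussianReal 0 1) := by
  simp_rw [eval_monomial_eq_prod, one_mul]
  exact integral_fintype_prod_eq_prod (𝕜 := ℝ) (fun i (y : ℝ) => y ^ s i)

theorem even_of_integral_monomial_ne_zero {s : ι →₀ ℕ}
    (h : ∫ θ : ι → ℝ, MvPolynomial.eval θ (MvPolynomial.monomial s (1 : ℝ))
      ∂(Measure.pi fun _ => gaussianReal 0 1) ≠ 0) (i : ι) : Even (s i) := by
  by_contra hi
  rw [integral_monomial] at h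
  exact h (Finset.prod_eq_zero (Finset.mem_univ i)
    (integral_odd_pow_gaussianReal (Nat.not_even_iff_odd.1 hi)))

/-- A bound for the absolute Gaussian moments of monomials of degree at most `D`, whatever the
number of variables. -/
noncomputable def momentBound (D : ℕ) : ℝ :=
  (1 + ∑ k ∈ Finset.range (D + 1), |∫ y : ℝ, y ^ k ∂(gaussianReal 0 1)|) ^ D

theorem abs_integral_monomial_le {s : ι →₀ ℕ} {D : ℕ} (hs : s.degree ≤ D) :
    |∫ θ : ι → ℝ, MvPolynomial.eval θ (MvPolynomial.monomial s (1 : ℝ))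
      ∂(Measure.pi fun _ => gaussianReal 0 1)| ≤ momentBound D := by
  set B : ℝ := 1 + ∑ k ∈ Finset.range (D + 1), |∫ y : ℝ, y ^ k ∂(gaussianReal 0 1)| with hB
  have hB1 : 1 ≤ B := by
    rw [hB]
    exact le_add_of_nonneg_right (Finset.sum_nonneg fun _ _ => abs_nonneg _)
  rw [integral_monomial, Finset.abs_prod]
  -- Variables outside the support contribute the zeroth moment, which is 1. At most `D` factors
  -- remain, so the bound does not see the number of variables, which grows with the width.
  have h1 : ∏ i, |∫ y : ℝ, y ^ s i ∂(gaussianReal 0 1)| =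
      ∏ i ∈ s.support, |∫ y : ℝ, y ^ s i ∂(gaussianReal 0 1)| := by
    refine (Finset.prod_subset (Finset.subset_univ _) fun i _ hi => ?_).symm
    simp [Finsupp.notMem_support_iff.1 hi]
  have hcard : s.support.card ≤ D := by
    refine le_trans ?_ hs
    rw [Finsupp.degree_apply, Finset.card_eq_sum_ones]
    exact Finset.sum_le_sum fun i hi => Nat.one_le_iff_ne_zero.2 (Finsupp.mem_support_iff.1 hi)
  rw [h1]
  calc ∏ i ∈ s.support, |∫ y : ℝ, y ^ s i ∂(gaussianReal 0 1)|
      ≤ ∏ _i ∈ s.support, B := by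
        refine Finset.prod_le_prod (fun _ _ => abs_nonneg _) fun i _ => ?_
        have hi : s i ∈ Finset.range (D + 1) :=
          Finset.mem_range.2 (Nat.lt_succ_of_le ((Finsupp.le_degree i s).trans hs))
        have := Finset.single_le_sum
          (f := fun k => |∫ y : ℝ, y ^ k ∂(gaussianReal 0 1)|) (fun _ _ => abs_nonneg _) hi
        rw [hB]
        linarith
    _ = B ^ s.support.card := Finset.prod_const B
    _ ≤ B ^ D := pow_le_pow_right₀ hB1 hcard

theorem momentBound_nonneg (D : ℕ) : 0 ≤ momentBound D :=
  pow_nonneg (add_nonneg zero_le_one (Finset.sum_nonneg fun _ _ => abs_nonneg _)) D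

end Moments

/-! ### Correlations of monomials -/

section MonomialCorrelation

variable {m : ℕ} (S : IndexStructure m) {ι : Type}

/-- The exponents removed from the `K`-th monomial by its derivatives. -/
noncomputable def IndexStructure.derivDegree (μ : Fin S.numPairs → ι) (K : Fin m) : ι →₀ ℕ :=
  ∑ j, Finsupp.single (μ (S.label ⟨K, j⟩)) 1

theorem IndexStructure.derivDegree_ne_zero (μ : Fin S.numPairs → ι) (K : Fin m)
    (j : Fin (S.rank K)) : S.derivDegree μ K (μ (S.label ⟨K, j⟩)) ≠ 0 := by
  classical
  have h : Finsupp.single (μ (S.label ⟨K, j⟩)) 1 ≤ S.derivDegree μ K :=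
    Finset.single_le_sum (f := fun j => Finsupp.single (μ (S.label ⟨K, j⟩)) 1)
      (fun _ _ => zero_le) (Finset.mem_univ j)
  have := h (μ (S.label ⟨K, j⟩))
  rw [Finsupp.single_eq_same] at this
  omega

theorem IndexStructure.even_sum_derivDegree (μ : Fin S.numPairs → ι) (i : ι) :
    Even (∑ K, S.derivDegree μ K i) := by
  classical
  -- The tensor slots are regrouped by their label, and each label has exactly two slots.
  have h : ∑ K, S.derivDegree μ K i = ∑ a, 2 * (Finsupp.single (μ a) 1 : ι →₀ ℕ) i := by
    simp only [IndexStructure.derivDegree, Finsupp.finsetSum_apply]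
    rw [← Fintype.sum_sigma' (fun K (j : Fin (S.rank K)) =>
      (Finsupp.single (μ (S.label ⟨K, j⟩)) 1 : ι →₀ ℕ) i)]
    rw [← Finset.sum_fiberwise (s := Finset.univ) (g := S.label)]
    refine Finset.sum_congr rfl fun a _ => ?_
    rw [Finset.sum_congr rfl (g := fun _ => (Finsupp.single (μ a) 1 : ι →₀ ℕ) i), Finset.sum_const,
      S.pairs a, smul_eq_mul]
    intro s hs
    rw [← (Finset.mem_filter.1 hs).2]
  rw [h]
  exact Finset.even_sum _ fun a _ => even_two_mul _

theorem IndexStructure.exists_label_eq (a : Fin S.numPairs) : ∃ K j, S.label ⟨K, j⟩ = a := by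
  have h : (Finset.univ.filter fun s => S.label s = a).Nonempty :=
    Finset.card_pos.1 (by rw [S.pairs a]; norm_num)
  obtain ⟨⟨K, j⟩, hs⟩ := h
  exact ⟨K, j, (Finset.mem_filter.1 hs).2⟩

variable [Fintype ι]

/-- The expected product of derivatives of monomials with exponents `s K`. -/
noncomputable def IndexStructure.monomialExpectation (s : Fin m → ι →₀ ℕ)
    (μ : Fin S.numPairs → ι) : ℝ :=
  ∫ θ : ι → ℝ, ∏ K, MvPolynomial.eval θ (iterPDeriv (S.rank K) (fun j => μ (S.label ⟨K, j⟩))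
    (MvPolynomial.monomial (s K) 1)) ∂(Measure.pi fun _ => gaussianReal 0 1)

/-- Derivatives and products of monomials are monomials up to a scalar, so the expectation is a
single Gaussian moment times combinatorial factors. -/
theorem IndexStructure.monomialExpectation_eq (s : Fin m → ι →₀ ℕ) (μ : Fin S.numPairs → ι) :
    ∃ c : Fin m → ℕ, (∀ K, c K ≤ (s K).degree ^ S.rank K) ∧
      (∀ K, c K ≠ 0 → S.derivDegree μ K ≤ s K) ∧
      S.monomialExpectation s μ = (∏ K, (c K : ℝ)) *
        ∫ θ : ι → ℝ, MvPolynomial.eval θ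
          (MvPolynomial.monomial (∑ K, (s K - S.derivDegree μ K)) (1 : ℝ))
          ∂(Measure.pi fun _ => gaussianReal 0 1) := by
  choose c hc hs h using fun K =>
    iterPDeriv_monomial (s K) (S.rank K) (fun j => μ (S.label ⟨K, j⟩))
  refine ⟨c, hc, hs, ?_⟩
  rw [IndexStructure.monomialExpectation, ← integral_const_mul]
  refine integral_congr_ae (Eventually.of_forall fun θ => ?_)
  simp only [h, MvPolynomial.monomial_sum_one, map_prod, ← Finset.prod_mul_distrib]
  refine Finset.prod_congr rfl fun K _ => ?_
  rw [eval_monomial_eq_prod, eval_monomial_eq_prod, one_mul]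
  rfl

/-- A configuration of exponents that can contribute to a correlation function. -/
def IndexStructure.IsContributing (s : Fin m → ι →₀ ℕ) : Prop :=
  (∀ i, Even (∑ K, s K i)) ∧ ∀ I J, S.clusterGraph.Adj I J → ∃ i, s I i ≠ 0 ∧ s J i ≠ 0

/-- A nonzero moment has even exponents, and the derivatives remove an even total power of each
parameter, so the original exponents are even as well. A parameter that differentiates a tensor
without killing it must occur in its monomial; an index shared by two tensors gives a shared
parameter. -/
theorem IndexStructure.isContributing_of_monomialExpectation_ne_zero {s : Fin m → ι →₀ ℕ}
    {μ : Fin S.numPairs → ι} (h : S.monomialExpectation s μ ≠ 0) :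
    S.IsContributing s ∧ ∀ a, μ a ∈ (∑ K, s K).support := by
  obtain ⟨c, -, hs, he⟩ := S.monomialExpectation_eq s μ
  rw [he] at h
  obtain ⟨hc, hi⟩ := mul_ne_zero_iff.1 h
  have hle : ∀ K, S.derivDegree μ K ≤ s K := fun K =>
    hs K (by exact_mod_cast Finset.prod_ne_zero_iff.1 hc K (Finset.mem_univ K))
  have hne : ∀ K j, s K (μ (S.label ⟨K, j⟩)) ≠ 0 := fun K j h0 => by
    have := hle K (μ (S.label ⟨K, j⟩))
    have := S.derivDegree_ne_zero μ K j
    omega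
  refine ⟨⟨fun i => ?_, ?_⟩, fun a => ?_⟩
  · have h1 := even_of_integral_monomial_ne_zero hi i
    have h2 : ∑ K, s K i = (∑ K, (s K - S.derivDegree μ K)) i + ∑ K, S.derivDegree μ K i := by
      rw [Finsupp.finsetSum_apply, ← Finset.sum_add_distrib]
      refine Finset.sum_congr rfl fun K _ => ?_
      have := hle K i
      simp only [Finsupp.coe_tsub, Pi.sub_apply]
      omega
    rw [h2]
    exact h1.add (S.even_sum_derivDegree μ i)
  · rintro I J ⟨-, i, j, hij⟩
    exact ⟨μ (S.label ⟨I, i⟩), hne I i, hij ▸ hne J j⟩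
  · obtain ⟨K, j, rfl⟩ := S.exists_label_eq a
    rw [Finsupp.mem_support_iff, Finsupp.finsetSum_apply]
    intro h0
    exact hne K j (Finset.sum_eq_zero_iff.1 h0 K (Finset.mem_univ K))

theorem IndexStructure.abs_monomialExpectation_le {s : Fin m → ι →₀ ℕ} {D : ℕ}
    (hD : (∑ K, s K).degree ≤ D) (μ : Fin S.numPairs → ι) :
    |S.monomialExpectation s μ| ≤ (∏ K, (D : ℝ) ^ S.rank K) * momentBound D := by
  obtain ⟨c, hc, -, he⟩ := S.monomialExpectation_eq s μ
  rw [he, abs_mul]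
  have hdeg : ∀ K, (s K).degree ≤ D := fun K =>
    (Finsupp.degree_mono (Finset.single_le_sum (f := s) (fun _ _ => zero_le)
      (Finset.mem_univ K))).trans hD
  refine mul_le_mul ?_ (abs_integral_monomial_le ?_) (abs_nonneg _)
    (Finset.prod_nonneg fun K _ => by positivity)
  · rw [abs_of_nonneg (Finset.prod_nonneg fun K _ => by positivity)]
    refine Finset.prod_le_prod (fun K _ => by positivity) fun K _ => ?_
    exact_mod_cast (hc K).trans (Nat.pow_le_pow_left (hdeg K) _)
  · exact (Finsupp.degree_mono (Finset.sum_le_sum fun K _ => tsub_le_self)).trans hD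

/-- A bound for correlations of monomials of total degree at most `D`, whatever the number of
variables. -/
noncomputable def IndexStructure.monomialBound (D : ℕ) : ℝ :=
  (D : ℝ) ^ S.numPairs * ((∏ K, (D : ℝ) ^ S.rank K) * momentBound D)

theorem IndexStructure.monomialBound_nonneg (D : ℕ) : 0 ≤ S.monomialBound D :=
  mul_nonneg (by positivity)
    (mul_nonneg (Finset.prod_nonneg fun K _ => by positivity) (momentBound_nonneg D))

theorem IndexStructure.abs_sum_monomialExpectation_le {s : Fin m → ι →₀ ℕ} {D : ℕ}
    (hD : (∑ K, s K).degree ≤ D) :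
    |∑ μ, S.monomialExpectation s μ| ≤ S.monomialBound D := by
  classical
  set B : ℝ := (∏ K, (D : ℝ) ^ S.rank K) * momentBound D
  set A : Finset (Fin S.numPairs → ι) := Fintype.piFinset fun _ => (∑ K, s K).support
  have hA : (A.card : ℝ) ≤ (D : ℝ) ^ S.numPairs := by
    have hcard : (∑ K, s K).support.card ≤ D := by
      refine le_trans ?_ hD
      rw [Finsupp.degree_apply, Finset.card_eq_sum_ones]
      exact Finset.sum_le_sum fun i hi => Nat.one_le_iff_ne_zero.2 (Finsupp.mem_support_iff.1 hi)
    have : A.card ≤ D ^ S.numPairs := by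
      simpa [A] using Nat.pow_le_pow_left hcard S.numPairs
    exact_mod_cast this
  -- Only index values in the support survive: at most `D` choices per index, although the number of
  -- parameters grows with `n`.
  have hsum : ∑ μ, S.monomialExpectation s μ = ∑ μ ∈ A, S.monomialExpectation s μ := by
    refine (Finset.sum_subset (Finset.subset_univ _) fun μ _ hμ => ?_).symm
    by_contra h
    exact hμ (Fintype.mem_piFinset.2 (S.isContributing_of_monomialExpectation_ne_zero h).2)
  rw [hsum]
  calc |∑ μ ∈ A, S.monomialExpectation s μ| ≤ ∑ μ ∈ A, |S.monomialExpectation s μ| :=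
        Finset.abs_sum_le_sum_abs _ _
    _ ≤ ∑ _μ ∈ A, B := Finset.sum_le_sum fun μ _ => S.abs_monomialExpectation_le hD μ
    _ = A.card * B := by rw [Finset.sum_const, nsmul_eq_mul]
    _ ≤ (D : ℝ) ^ S.numPairs * B := mul_le_mul_of_nonneg_right hA
        (mul_nonneg (Finset.prod_nonneg fun K _ => by positivity) (momentBound_nonneg D))

end MonomialCorrelation

/-! ### Expansion of the network function into rooted trees -/

/-- A monomial template. The vertices are a root `none` and the elements of `Vert`; each vertex
stands for a neuron. The template is a tree whose edges are entries of the matrices `W`, and it is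
decorated by entries of `U` at its vertices. -/
structure RootedTerm (d L : ℕ) where
  Vert : Type
  [fintype : Fintype Vert]
  [decidableEq : DecidableEq Vert]
  uEdges : Multiset (Option Vert × Fin d)
  wEdges : Multiset (Fin (L - 1) × Option Vert × Option Vert)
  card_wEdges : wEdges.card = Fintype.card Vert
  connected : ∀ p : Option Vert → Prop, (∀ w ∈ wEdges, p w.2.1 ↔ p w.2.2) → p none → ∀ a, p a

attribute [instance] RootedTerm.fintype RootedTerm.decidableEq

/-- Splits off the neuron at the root. This turns a matrix-vector product, or the readout by `V`,
into a sum over assignments with one more vertex. -/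
theorem sum_option_arrow {V β : Type} [Fintype V] [DecidableEq V] [Fintype β]
    (g : β → ℝ) (h : (Option V → β) → ℝ) :
    ∑ σ : Option V → β, g (σ none) * h σ =
      ∑ j, g j * ∑ σ : V → β, h fun o => o.elim j σ := by
  rw [← (Equiv.piOptionEquivProd (β := fun _ => β)).symm.sum_comp, Fintype.sum_prod_type]
  refine Finset.sum_congr rfl fun j _ => ?_
  rw [Finset.mul_sum]
  refine Finset.sum_congr rfl fun σ _ => ?_
  congr 2
  funext o
  cases o <;> rfl

namespace RootedTerm

variable {d L : ℕ}

/-- The entries of `U` and `W` in the template, for an assignment `σ` of neurons to vertices. -/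
def innerParams (T : RootedTerm d L) {n : ℕ} (σ : Option T.Vert → Fin n) :
    Multiset (Param d L n) :=
  T.uEdges.map (fun u => Param.U (σ u.1) u.2) +
    T.wEdges.map fun w => Param.W w.1 (σ w.2.1) (σ w.2.2)

/-- The entries of `U`, `W` and `V` in the template, with one entry of `V` at the root. -/
def params (T : RootedTerm d L) {n : ℕ} (σ : Option T.Vert → Fin n) : Multiset (Param d L n) :=
  Param.V (σ none) ::ₘ T.innerParams σ

/-- Families, indexed by the width `n`, of functions of the parameters and of a neuron. -/
abbrev Family (d L : ℕ) : Type := (n : ℕ) → (Param d L n → ℝ) → Fin n → ℝ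

/-- The sum of all the monomials with a given template and a given neuron at the root. -/
noncomputable def value (T : RootedTerm d L) : Family d L := fun n θ i =>
  (√(n : ℝ))⁻¹ ^ Fintype.card T.Vert *
    ∑ σ : T.Vert → Fin n, ((T.innerParams fun o => o.elim i σ).map θ).prod

/-- The template consisting of the root only. -/
abbrev one (d L : ℕ) : RootedTerm d L where
  Vert := Empty
  uEdges := 0
  wEdges := 0
  card_wEdges := by simp
  connected p _ h0 a := by
    cases a with
    | none => exact h0
    | some a => exact a.elim

theorem value_one : (one d L).value = 1 := by
  funext n θ i
  simp [value, one, innerParams]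

/-- The template consisting of the root, with one entry of `U`. -/
abbrev ofU (L : ℕ) (α : Fin d) : RootedTerm d L where
  Vert := Empty
  uEdges := {(none, α)}
  wEdges := 0
  card_wEdges := by simp
  connected p _ h0 a := by
    cases a with
    | none => exact h0
    | some a => exact a.elim

theorem value_ofU (α : Fin d) : (ofU L α).value = fun _ θ i => θ (.U i α) := by
  funext n θ i
  simp [value, ofU, innerParams]

/-- Two templates joined at their roots. -/
abbrev mul (T₁ T₂ : RootedTerm d L) : RootedTerm d L where
  Vert := T₁.Vert ⊕ T₂.Vert
  uEdges := T₁.uEdges.map (fun u => (u.1.map Sum.inl, u.2)) +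
    T₂.uEdges.map fun u => (u.1.map Sum.inr, u.2)
  wEdges := T₁.wEdges.map (fun w => (w.1, w.2.1.map Sum.inl, w.2.2.map Sum.inl)) +
    T₂.wEdges.map fun w => (w.1, w.2.1.map Sum.inr, w.2.2.map Sum.inr)
  card_wEdges := by simp [card_wEdges]
  connected p hp h0 a := by
    have h1 := T₁.connected (fun o => p (o.map Sum.inl))
      (fun w hw => hp _ (Multiset.mem_add.2 (Or.inl (Multiset.mem_map_of_mem _ hw)))) h0
    have h2 := T₂.connected (fun o => p (o.map Sum.inr))
      (fun w hw => hp _ (Multiset.mem_add.2 (Or.inr (Multiset.mem_map_of_mem _ hw)))) h0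
    rcases a with _ | a | a
    · exact h0
    · exact h1 (some a)
    · exact h2 (some a)

theorem innerParams_mul (T₁ T₂ : RootedTerm d L) {n : ℕ}
    (σ : Option (T₁.Vert ⊕ T₂.Vert) → Fin n) :
    (T₁.mul T₂).innerParams σ = T₁.innerParams (fun o => σ (o.map Sum.inl)) +
      T₂.innerParams (fun o => σ (o.map Sum.inr)) := by
  simp only [innerParams, mul, Multiset.map_add, Multiset.map_map, Function.comp_def]
  abel

theorem value_mul (T₁ T₂ : RootedTerm d L) : (T₁.mul T₂).value = T₁.value * T₂.value := by
  funext n θ i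
  have hσ : ∀ σ : T₁.Vert ⊕ T₂.Vert → Fin n,
      (((T₁.mul T₂).innerParams fun o => o.elim i σ).map θ).prod =
        ((T₁.innerParams fun o => o.elim i (σ ∘ Sum.inl)).map θ).prod *
          ((T₂.innerParams fun o => o.elim i (σ ∘ Sum.inr)).map θ).prod := fun σ => by
    rw [innerParams_mul, Multiset.map_add, Multiset.prod_add]
    congr 4 <;> funext o <;> cases o <;> rfl
  have hcard : Fintype.card (T₁.mul T₂).Vert = Fintype.card T₁.Vert + Fintype.card T₂.Vert :=
    Fintype.card_sum
  simp only [value, Pi.mul_apply, hcard]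
  rw [mul_mul_mul_comm, ← pow_add, Finset.sum_mul_sum, ← Finset.sum_product',
    Finset.univ_product_univ,
    ← (Equiv.sumArrowEquivProdArrow T₁.Vert T₂.Vert (Fin n)).sum_comp]
  congr 1
  exact Finset.sum_congr rfl fun σ _ => hσ σ

/-- A template placed below a new root, to which it is joined by an entry of `W`. -/
abbrev graft (ℓ : Fin (L - 1)) (T : RootedTerm d L) : RootedTerm d L where
  Vert := Option T.Vert
  uEdges := T.uEdges.map fun u => (some u.1, u.2)
  wEdges := (ℓ, none, some none) ::ₘ T.wEdges.map fun w => (w.1, some w.2.1, some w.2.2)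
  card_wEdges := by simp [card_wEdges]
  connected p hp h0 a := by
    have h1 := T.connected (fun o => p (some o))
      (fun w hw => hp _ (Multiset.mem_cons_of_mem (Multiset.mem_map_of_mem _ hw)))
      ((hp _ (Multiset.mem_cons_self _ _)).1 h0)
    cases a with
    | none => exact h0
    | some a => exact h1 a

theorem value_graft (ℓ : Fin (L - 1)) (T : RootedTerm d L) :
    (graft ℓ T).value =
      fun (n : ℕ) θ i => (√(n : ℝ))⁻¹ * ∑ j, θ (.W ℓ i j) * T.value n θ j := by
  funext n θ i
  have hσ : ∀ σ : Option T.Vert → Fin n,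
      (((graft ℓ T).innerParams fun o => o.elim i σ).map θ).prod =
        θ (.W ℓ i (σ none)) * ((T.innerParams σ).map θ).prod := fun σ => by
    simp only [innerParams, graft, Multiset.map_add, Multiset.map_cons, Multiset.map_map,
      Function.comp_def, Multiset.prod_add, Multiset.prod_cons, Option.elim]
    ring
  have hcard : Fintype.card (graft ℓ T).Vert = Fintype.card T.Vert + 1 := Fintype.card_option
  have hsum : ∑ σ : (graft ℓ T).Vert → Fin n,
      (((graft ℓ T).innerParams fun o => o.elim i σ).map θ).prod =
      ∑ σ : Option T.Vert → Fin n, θ (.W ℓ i (σ none)) * ((T.innerParams σ).map θ).prod :=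
    Finset.sum_congr rfl fun σ _ => hσ σ
  simp only [value, hcard, hsum]
  rw [sum_option_arrow (fun j => θ (.W ℓ i j)) fun σ => ((T.innerParams σ).map θ).prod, pow_succ',
    mul_assoc, Finset.mul_sum]
  congr 1
  exact Finset.sum_congr rfl fun i _ => mul_left_comm _ _ _

/-- The families spanned by the templates. -/
noncomputable def spanSubalgebra (d L : ℕ) : Subalgebra ℝ (Family d L) :=
  (Submodule.span ℝ (Set.range (value (d := d) (L := L)))).toSubalgebra
    (Submodule.subset_span ⟨one d L, value_one⟩) (fun f g hf hg => by
      have h := Submodule.mul_mem_mul hf hg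
      rw [Submodule.span_mul_span] at h
      refine Submodule.span_mono ?_ h
      rintro _ ⟨_, ⟨T₁, rfl⟩, _, ⟨T₂, rfl⟩, rfl⟩
      exact ⟨T₁.mul T₂, value_mul T₁ T₂⟩)

theorem value_mem_spanSubalgebra (T : RootedTerm d L) : T.value ∈ spanSubalgebra d L :=
  Submodule.subset_span ⟨T, rfl⟩

/-- The operation is linear in `g`, so it need only be checked on templates, where it is `graft`. -/
theorem preAct_mem_spanSubalgebra (ℓ : Fin (L - 1)) {g : Family d L}
    (hg : g ∈ spanSubalgebra d L) :
    (fun (n : ℕ) θ i => (√(n : ℝ))⁻¹ * ∑ j, θ (.W ℓ i j) * g n θ j : Family d L) ∈ spanSubalgebra d L := by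
  let Φ : Family d L →ₗ[ℝ] Family d L :=
    { toFun := fun g n θ i => (√(n : ℝ))⁻¹ * ∑ j, θ (.W ℓ i j) * g n θ j
      map_add' := fun f g => by
        funext n θ i
        simp [mul_add, Finset.sum_add_distrib]
      map_smul' := fun c g => by
        funext n θ i
        simp [Finset.mul_sum, mul_left_comm] }
  have h : Submodule.span ℝ (Set.range (value (d := d) (L := L))) ≤
      (Subalgebra.toSubmodule (spanSubalgebra d L)).comap Φ := by
    rw [Submodule.span_le]
    rintro _ ⟨T, rfl⟩
    change Φ T.value ∈ spanSubalgebra d L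
    have : Φ T.value = (graft ℓ T).value := (value_graft ℓ T).symm
    rw [this]
    exact value_mem_spanSubalgebra _
  exact h hg

theorem polynomial_eval_mem_spanSubalgebra (p : Polynomial ℝ) {g : Family d L}
    (hg : g ∈ spanSubalgebra d L) :
    (fun n θ i => p.eval (g n θ i)) ∈ spanSubalgebra d L := by
  -- Families form an algebra under pointwise operations across all widths, so applying `p`
  -- entrywise is evaluating `p` in that algebra, with coefficients independent of `n`.
  have h : (fun n θ i => p.eval (g n θ i)) = Polynomial.aeval g p := by
    funext n θ i
    simp [Polynomial.aeval_def, Polynomial.eval₂_eq_sum, Polynomial.eval_eq_sum, Polynomial.sum,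
      Finset.sum_apply]
  rw [h]
  exact (Algebra.adjoin_le (Set.singleton_subset_iff.2 hg)) (p.aeval_mem_adjoin_singleton ℝ g)

theorem postAct_mem_spanSubalgebra (φ : Fin L → Polynomial ℝ) (x : Fin d → ℝ) (ℓ : ℕ)
    (h : ℓ < L) : (fun _ θ i => postAct φ θ x ℓ h i) ∈ spanSubalgebra d L := by
  induction ℓ with
  | zero =>
    simp only [postAct]
    refine polynomial_eval_mem_spanSubalgebra _ ?_
    have hU : (∑ α, ((√(d : ℝ))⁻¹ * x α) • (ofU L α).value : Family d L) ∈ spanSubalgebra d L :=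
      Subalgebra.sum_mem _ fun α _ => Subalgebra.smul_mem _ (value_mem_spanSubalgebra _) _
    convert! hU using 1
    funext n θ i
    simp only [value_ofU, Finset.sum_apply, Pi.smul_apply, smul_eq_mul, Finset.mul_sum]
    exact Finset.sum_congr rfl fun α _ => by ring
  | succ ℓ ih =>
    simp only [postAct]
    exact polynomial_eval_mem_spanSubalgebra _ (preAct_mem_spanSubalgebra _ (ih _))

/-- The exponents of the monomial with a given template and given neurons at its vertices. -/
noncomputable def exponent (T : RootedTerm d L) {n : ℕ} (σ : Option T.Vert → Fin n) : Param d L n →₀ ℕ :=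
  Multiset.toFinsupp (T.params σ)

theorem monomial_toFinsupp_eval {ι : Type} [DecidableEq ι] (s : Multiset ι) (θ : ι → ℝ) :
    MvPolynomial.eval θ (MvPolynomial.monomial (Multiset.toFinsupp s) 1) = (s.map θ).prod := by
  induction s using Multiset.induction_on with
  | empty => simp
  | cons a s ih =>
    rw [← Multiset.singleton_add, map_add, Multiset.toFinsupp_singleton, ← mul_one (1 : ℝ),
      ← MvPolynomial.monomial_mul, map_mul, ih]
    simp [MvPolynomial.eval_monomial]

/-- The sum of all the monomials with a given template, as a polynomial. -/
noncomputable def poly (T : RootedTerm d L) (n : ℕ) : MvPolynomial (Param d L n) ℝ :=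
  (√(n : ℝ))⁻¹ ^ (Fintype.card T.Vert + 1) •
    ∑ σ : Option T.Vert → Fin n, MvPolynomial.monomial (T.exponent σ) 1

theorem eval_poly (T : RootedTerm d L) (n : ℕ) (θ : Param d L n → ℝ) :
    MvPolynomial.eval θ (T.poly n) = (√(n : ℝ))⁻¹ * ∑ i, θ (.V i) * T.value n θ i := by
  simp only [poly, MvPolynomial.smul_eval, map_sum, exponent, monomial_toFinsupp_eval, params,
    Multiset.map_cons, Multiset.prod_cons, value]
  rw [sum_option_arrow (fun i => θ (.V i)) fun σ => ((T.innerParams σ).map θ).prod, pow_succ',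
    mul_assoc, Finset.mul_sum]
  congr 1
  exact Finset.sum_congr rfl fun i _ => mul_left_comm _ _ _

/-- The network function is a linear combination, uniformly in the width, of sums of monomials
with a given template. -/
theorem exists_network_eq (hL : 0 < L) (φ : Fin L → Polynomial ℝ) (x : Fin d → ℝ) :
    ∃ c : RootedTerm d L →₀ ℝ, ∀ n : ℕ, network (n := n) hL φ x =
      fun θ => MvPolynomial.eval θ (∑ T ∈ c.support, c T • T.poly n) := by
  have h := postAct_mem_spanSubalgebra φ x (L - 1) (Nat.sub_lt hL Nat.one_pos)
  obtain ⟨c, hc⟩ := Finsupp.mem_span_range_iff_exists_finsupp.1 h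
  refine ⟨c, fun n => ?_⟩
  funext θ
  have hi : ∀ i, postAct φ θ x (L - 1) (Nat.sub_lt hL Nat.one_pos) i =
      ∑ T ∈ c.support, c T * T.value n θ i := fun i => by
    have := congrFun (congrFun (congrFun hc n) θ) i
    rw [← this, Finsupp.sum]
    simp
  simp only [network, hi, map_sum, MvPolynomial.smul_eval, eval_poly, Finset.mul_sum]
  rw [Finset.sum_comm]
  refine Finset.sum_congr rfl fun T _ => Finset.sum_congr rfl fun i _ => by ring

end RootedTerm

/-! ### Counting the neurons of contributing configurations -/

/-- A finite graph has at most as many vertices as it has edges and connected components. -/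
theorem card_le_card_edges_add_card_quot {X β : Type} [Fintype X] [Fintype β] (src tgt : β → X)
    [Fintype (Quot fun a b => ∃ e, src e = a ∧ tgt e = b)] :
    Fintype.card X ≤
      Fintype.card β + Fintype.card (Quot fun a b => ∃ e, src e = a ∧ tgt e = b) := by
  -- `δ` is the coboundary map. A function in its kernel agrees at both ends of every edge, hence
  -- descends to the components, and rank-nullity gives the bound.
  let δ : (X → ℝ) →ₗ[ℝ] (β → ℝ) := LinearMap.funLeft ℝ ℝ src - LinearMap.funLeft ℝ ℝ tgt
  let π := LinearMap.funLeft ℝ ℝ (Quot.mk fun a b => ∃ e, src e = a ∧ tgt e = b)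
  have hker : LinearMap.ker δ ≤ LinearMap.range π := fun g hg => by
    refine ⟨Quot.lift g ?_, rfl⟩
    rintro _ _ ⟨e, rfl, rfl⟩
    exact sub_eq_zero.1 (congrFun (LinearMap.mem_ker.1 hg) e)
  have h1 := LinearMap.finrank_range_add_finrank_ker δ
  have h2 : Module.finrank ℝ (LinearMap.range δ) ≤ Fintype.card β :=
    (Submodule.finrank_le _).trans_eq (Module.finrank_fintype_fun_eq_card ℝ)
  have h3 : Module.finrank ℝ (LinearMap.ker δ) ≤
      Fintype.card (Quot fun a b => ∃ e, src e = a ∧ tgt e = b) :=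
    (Submodule.finrank_mono hker).trans
      ((LinearMap.finrank_range_le π).trans_eq (Module.finrank_fintype_fun_eq_card ℝ))
  rw [Module.finrank_fintype_fun_eq_card] at h1
  omega

/-- Each fibre of `κ` is a nonempty union of clusters of even total size. It contains an even
cluster, or else a positive even number of odd ones. With weight 2 for even clusters and 1 for odd
ones, every fibre has weight at least 2. -/
theorem two_mul_card_le_of_even_fibers {m : ℕ} (G : SimpleGraph (Fin m)) {Q : Type} [Fintype Q]
    [DecidableEq Q] (κ : Fin m → Q) (hadj : ∀ I J, G.Adj I J → κ I = κ J)
    (hsurj : Function.Surjective κ)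
    (heven : ∀ q, Even (Finset.univ.filter fun K => κ K = q).card) :
    2 * Fintype.card Q ≤ 2 * {c : G.ConnectedComponent | Even c.supp.ncard}.ncard +
      {c : G.ConnectedComponent | Odd c.supp.ncard}.ncard := by
  classical
  have hwalk : ∀ (I J : Fin m) (p : G.Walk I J), κ I = κ J := fun I J p => by
    induction p with
    | nil => rfl
    | cons h _ ih => exact (hadj _ _ h).trans ih
  let κ' : G.ConnectedComponent → Q :=
    SimpleGraph.ConnectedComponent.lift κ fun I J p _ => hwalk I J p
  have hκ' : ∀ K, κ' (G.connectedComponentMk K) = κ K := fun K => rfl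
  have hfib : ∀ q, (Finset.univ.filter fun K => κ K = q).card =
      ∑ c with κ' c = q, c.supp.ncard := fun q => by
    rw [Finset.card_eq_sum_card_fiberwise (f := G.connectedComponentMk)
      (t := Finset.univ.filter fun c => κ' c = q) (fun K hK => by simpa [hκ'] using hK)]
    refine Finset.sum_congr rfl fun c hc => ?_
    rw [Set.ncard_eq_toFinset_card']
    congr 1
    ext K
    have hc' : κ' c = q := (Finset.mem_filter.1 hc).2
    simp only [Finset.mem_filter, Finset.mem_univ, true_and, Set.mem_toFinset,
      SimpleGraph.ConnectedComponent.mem_supp_iff, and_iff_right_iff_imp]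
    rintro rfl
    exact hc'
  have hq : ∀ q, 2 ≤ ∑ c with κ' c = q, if Even c.supp.ncard then 2 else 1 := fun q => by
    obtain ⟨K, hK⟩ := hsurj q
    have hmem : G.connectedComponentMk K ∈ Finset.univ.filter fun c => κ' c = q := by
      simpa [hκ'] using hK
    by_cases h : ∃ c ∈ Finset.univ.filter (fun c => κ' c = q), Even c.supp.ncard
    · obtain ⟨c, hc, he⟩ := h
      have := Finset.single_le_sum (f := fun c : G.ConnectedComponent =>
        if Even c.supp.ncard then 2 else 1) (fun _ _ => Nat.zero_le _) hc
      simpa [he] using this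
    · push Not at h
      have he := heven q
      rw [hfib, Finset.even_sum_iff_even_card_odd, Finset.filter_true_of_mem
        (fun c hc => Nat.not_even_iff_odd.1 (h c hc))] at he
      have hpos : 0 < (Finset.univ.filter fun c => κ' c = q).card := Finset.card_pos.2 ⟨_, hmem⟩
      rw [Finset.sum_congr rfl (g := fun _ => 1) (fun c hc => by rw [if_neg (h c hc)]),
        ← Finset.card_eq_sum_ones]
      obtain ⟨r, hr⟩ := he
      omega
  calc 2 * Fintype.card Q = ∑ _q : Q, 2 := by simp [mul_comm]
    _ ≤ ∑ q, ∑ c with κ' c = q, (if Even c.supp.ncard then 2 else 1) :=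
        Finset.sum_le_sum fun q _ => hq q
    _ = ∑ c : G.ConnectedComponent, if Even c.supp.ncard then 2 else 1 :=
        Finset.sum_fiberwise _ _ _
    _ = _ := by
        rw [Finset.sum_ite, Finset.sum_const, Finset.sum_const, Set.ncard_eq_toFinset_card',
          Set.ncard_eq_toFinset_card']
        simp [mul_comm]

/-- A neuron to which a parameter is attached. -/
def Param.neuron {d L n : ℕ} : Param d L n → Fin n
  | .U i _ => i
  | .W _ i _ => i
  | .V i => i

namespace RootedTerm

variable {d L n : ℕ} (T : RootedTerm d L) (σ : Option T.Vert → Fin n)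

theorem exponent_ne_zero_iff (p : Param d L n) : T.exponent σ p ≠ 0 ↔ p ∈ T.params σ := by
  simp [exponent]

theorem exists_eq_neuron {p : Param d L n} (hp : p ∈ T.params σ) : ∃ a, σ a = p.neuron := by
  simp only [params, innerParams, Multiset.mem_cons, Multiset.mem_add, Multiset.mem_map] at hp
  rcases hp with rfl | ⟨u, -, rfl⟩ | ⟨w, -, rfl⟩
  · exact ⟨none, rfl⟩
  · exact ⟨u.1, rfl⟩
  · exact ⟨w.2.1, rfl⟩

theorem wEdge_mem_params {w : Fin (L - 1) × Option T.Vert × Option T.Vert} (hw : w ∈ T.wEdges) :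
    Param.W w.1 (σ w.2.1) (σ w.2.2) ∈ T.params σ :=
  Multiset.mem_cons_of_mem (Multiset.mem_add.2 (Or.inr (Multiset.mem_map_of_mem
    (fun w => Param.W w.1 (σ w.2.1) (σ w.2.2)) hw)))

theorem exponent_V (i : Fin n) : T.exponent σ (.V i) = if σ none = i then 1 else 0 := by
  have h : Multiset.count (Param.V i) (T.innerParams σ) = 0 := by
    simp [innerParams]
  simp [exponent, params, Multiset.count_cons, h, eq_comm]

/-- Each tree edge supplies one entry of `W`, and there are as many edges as non-root vertices. This
ties the number of edges to the power of `n` in the prefactor. -/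
theorem sum_exponent_W :
    ∑ e : Fin (L - 1) × Fin n × Fin n, T.exponent σ (.W e.1 e.2.1 e.2.2) =
      Fintype.card T.Vert := by
  have hinj : Function.Injective
      fun e : Fin (L - 1) × Fin n × Fin n => (Param.W e.1 e.2.1 e.2.2 : Param d L n) := by
    rintro ⟨a, b, c⟩ ⟨a', b', c'⟩ h
    simpa using h
  have h : ∀ e : Fin (L - 1) × Fin n × Fin n, T.exponent σ (.W e.1 e.2.1 e.2.2) =
      Multiset.count e (T.wEdges.map fun w => (w.1, σ w.2.1, σ w.2.2)) := fun e => by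
    rw [← Multiset.count_map_eq_count' _ _ hinj, Multiset.map_map]
    simp [exponent, params, innerParams]
  rw [Finset.sum_congr rfl fun e _ => h e, Multiset.sum_count_eq_card (by simp),
    Multiset.card_map, T.card_wEdges]

theorem card_params : (T.params σ).card = 1 + T.uEdges.card + T.wEdges.card := by
  simp [params, innerParams]
  ring

end RootedTerm

/-- In a contributing configuration, the number of different neurons is bounded in terms of the
cluster graph: the graph formed by these neurons and the entries of `W` has at most half as many
edges as the templates, and each of its components meets an even number of templates. -/
theorem IndexStructure.two_mul_ncard_range_le {m d L n : ℕ} (S : IndexStructure m)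
    (T : Fin m → RootedTerm d L) (σ : (K : Fin m) → Option (T K).Vert → Fin n)
    (h : S.IsContributing fun K => (T K).exponent (σ K)) :
    2 * (Set.range fun v : Σ K, Option (T K).Vert => σ v.1 v.2).ncard ≤
      ∑ K, Fintype.card (T K).Vert + (2 * S.numEven + S.numOdd) := by
  classical
  obtain ⟨heven, hshare⟩ := h
  set X := Set.range fun v : Σ K, Option (T K).Vert => σ v.1 v.2
  let τ : (K : Fin m) → Option (T K).Vert → X := fun K a => ⟨σ K a, ⟨K, a⟩, rfl⟩
  -- Total multiplicity of each entry of `W`. Neurons of different layers with equal index are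
  -- identified; the count only needs the range of `σ`.
  let E : Fin (L - 1) × X × X → ℕ := fun e => ∑ K, (T K).exponent (σ K) (.W e.1 e.2.1 e.2.2)
  let β := {e // E e ≠ 0}
  let r : X → X → Prop := fun a b => ∃ e : β, e.1.2.1 = a ∧ e.1.2.2 = b
  have : Fintype (Quot r) := Fintype.ofFinite _
  have hQ : Fintype.card X ≤ Fintype.card β + Fintype.card (Quot r) :=
    card_le_card_edges_add_card_quot (fun e : β => e.1.2.1) (fun e : β => e.1.2.2)
  -- Each entry present has a positive even multiplicity, hence at least 2.
  have hβ : 2 * Fintype.card β ≤ ∑ K, Fintype.card (T K).Vert := by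
    calc 2 * Fintype.card β = ∑ _e : β, 2 := by simp [mul_comm]
      _ ≤ ∑ e : β, E e.1 := Finset.sum_le_sum fun e _ => by
          obtain ⟨k, hk⟩ := heven (.W e.1.1 e.1.2.1 e.1.2.2)
          have he : E e.1 ≠ 0 := e.2
          have : E e.1 = k + k := hk
          omega
      _ ≤ ∑ e : Fin (L - 1) × Fin n × Fin n,
            ∑ K, (T K).exponent (σ K) (.W e.1 e.2.1 e.2.2) := by
          let ε : β ↪ Fin (L - 1) × Fin n × Fin n :=
            ⟨fun e => (e.1.1, e.1.2.1, e.1.2.2), by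
              rintro ⟨⟨a, b, c⟩, h⟩ ⟨⟨a', b', c'⟩, h'⟩ hab
              simp only [Prod.mk.injEq] at hab
              exact Subtype.ext (Prod.ext hab.1
                (Prod.ext (Subtype.ext hab.2.1) (Subtype.ext hab.2.2)))⟩
          refine (Finset.sum_map Finset.univ ε fun e : Fin (L - 1) × Fin n × Fin n =>
            ∑ K, (T K).exponent (σ K) (.W e.1 e.2.1 e.2.2)).symm.trans_le ?_
          exact Finset.sum_le_sum_of_subset (Finset.subset_univ _)
      _ = ∑ K, Fintype.card (T K).Vert := by
          rw [Finset.sum_comm]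
          exact Finset.sum_congr rfl fun K _ => (T K).sum_exponent_W (σ K)
  -- `connected` is applied to the predicate "in the same component as the root", which is invariant
  -- along template edges.
  have hroot : ∀ K a, Quot.mk r (τ K a) = Quot.mk r (τ K none) := fun K =>
    (T K).connected (fun a => Quot.mk r (τ K a) = Quot.mk r (τ K none)) (fun w hw => by
      have hw' : E (w.1, τ K w.2.1, τ K w.2.2) ≠ 0 := fun h0 =>
        ((T K).exponent_ne_zero_iff (σ K) _).2 ((T K).wEdge_mem_params (σ K) hw)
          (Finset.sum_eq_zero_iff.1 h0 K (Finset.mem_univ K))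
      have : Quot.mk r (τ K w.2.1) = Quot.mk r (τ K w.2.2) :=
        Quot.sound ⟨⟨_, hw'⟩, rfl, rfl⟩
      rw [this]) rfl
  have hC := two_mul_card_le_of_even_fibers S.clusterGraph (fun K => Quot.mk r (τ K none))
    (fun I J hIJ => by
      obtain ⟨p, hpI, hpJ⟩ := hshare I J hIJ
      obtain ⟨a, ha⟩ := (T I).exists_eq_neuron (σ I) (((T I).exponent_ne_zero_iff _ p).1 hpI)
      obtain ⟨b, hb⟩ := (T J).exists_eq_neuron (σ J) (((T J).exponent_ne_zero_iff _ p).1 hpJ)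
      have hab : τ I a = τ J b := Subtype.ext (ha.trans hb.symm)
      rw [← hroot I a, ← hroot J b, hab])
    (fun q => by
      obtain ⟨⟨_, ⟨K, a⟩, rfl⟩, rfl⟩ := Quot.exists_rep q
      exact ⟨K, (hroot K a).symm⟩)
    (fun q => by
      -- Each template has exactly one entry of `V`, at its root, so the templates in a component
      -- are counted by exponents of `V`, each of which is even in total.
      have hsum : (Finset.univ.filter fun K => Quot.mk r (τ K none) = q).card =
          ∑ i : X with Quot.mk r i = q, ∑ K, (T K).exponent (σ K) (.V i) := by
        rw [Finset.sum_comm, Finset.card_filter]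
        refine Finset.sum_congr rfl fun K _ => ?_
        simp only [RootedTerm.exponent_V]
        have : ∀ i : X, (σ K none = i) = (i = τ K none) := fun i =>
          propext ⟨fun h => Subtype.ext h.symm, fun h => by rw [h]⟩
        simp only [this]
        simp [Finset.sum_ite_eq']
      rw [hsum]
      exact Finset.even_sum _ fun i _ => heven _)
  have hXc : X.ncard = Fintype.card X := by rw [Set.ncard_eq_toFinset_card', Set.toFinset_card]
  rw [hXc]
  change _ ≤ _ + (2 * Set.ncard _ + Set.ncard _)
  omega

/-- A map with at most `N` values factors as `A → Fin N → Fin n`. Positivity of `n` supplies a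
default value for the unused elements of `Fin N`. -/
theorem card_filter_ncard_range_le {A : Type} [Fintype A] [DecidableEq A] {n : ℕ} (hn : 0 < n)
    (N : ℕ) [DecidablePred fun σ : A → Fin n => (Set.range σ).ncard ≤ N] :
    (Finset.univ.filter fun σ : A → Fin n => (Set.range σ).ncard ≤ N).card ≤
      N ^ Fintype.card A * n ^ N := by
  classical
  have hsub : (Finset.univ.filter fun σ : A → Fin n => (Set.range σ).ncard ≤ N) ⊆
      (Finset.univ : Finset ((A → Fin N) × (Fin N → Fin n))).image fun p => p.2 ∘ p.1 := by
    intro σ hσ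
    have hN : Fintype.card (Set.range σ) ≤ Fintype.card (Fin N) := by
      have := (Finset.mem_filter.1 hσ).2
      rwa [Set.ncard_eq_toFinset_card', Set.toFinset_card, ← Fintype.card_fin N] at this
    obtain ⟨e⟩ := Function.Embedding.nonempty_of_card_le hN
    refine Finset.mem_image.2 ⟨(fun a => e ⟨σ a, a, rfl⟩,
      Function.extend e Subtype.val fun _ => ⟨0, hn⟩), Finset.mem_univ _, ?_⟩
    funext a
    simp only [Function.comp_apply]
    rw [e.injective.extend_apply]
  refine (Finset.card_le_card hsub).trans (Finset.card_image_le.trans ?_)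
  simp

/-! ### The asymptotic bound -/

namespace IndexStructure

variable {m d L : ℕ} (S : IndexStructure m)

/-- The correlation function of the sums of monomials with given templates. -/
noncomputable def templateCorrelation (T : Fin m → RootedTerm d L) (n : ℕ) : ℝ :=
  (∏ K, (√(n : ℝ))⁻¹ ^ (Fintype.card (T K).Vert + 1)) *
    ∑ σ : (K : Fin m) → Option (T K).Vert → Fin n,
      ∑ μ, S.monomialExpectation (fun K => (T K).exponent (σ K)) μ

theorem tensorProd_eq_eval {n : ℕ} (hL : 0 < L) (φ : Fin L → Polynomial ℝ) (x : Fin m → Fin d → ℝ)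
    {c : Fin m → RootedTerm d L →₀ ℝ}
    (hc : ∀ K, network (n := n) hL φ (x K) =
      fun θ => MvPolynomial.eval θ (∑ T ∈ (c K).support, c K T • T.poly n))
    (μ : Fin S.numPairs → Param d L n) (θ : Param d L n → ℝ) :
    S.tensorProd hL φ x μ θ = MvPolynomial.eval θ
      (∏ K, iterPDeriv (S.rank K) (fun j => μ (S.label ⟨K, j⟩))
        (∑ T ∈ (c K).support, c K T • T.poly n)) := by
  simp only [tensorProd, hc, derivTensor_mvPolynomial_eval, map_prod]

theorem integrable_tensorProd (hL : 0 < L) (φ : Fin L → Polynomial ℝ) (x : Fin m → Fin d → ℝ)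
    (n : ℕ) (μ : Fin S.numPairs → Param d L n) :
    Integrable (S.tensorProd hL φ x μ) (initLaw d L n) := by
  choose c hc using fun K => RootedTerm.exists_network_eq hL φ (x K)
  have h := funext (S.tensorProd_eq_eval hL φ x (fun K => hc K n) μ)
  rw [h]
  exact integrable_mvPolynomial_eval _

open Classical in
/-- The correlation function of the network is a linear combination, uniformly in the width, of
correlation functions of templates. -/
theorem correlation_eq_sum {n : ℕ} (hL : 0 < L) (φ : Fin L → Polynomial ℝ)
    (x : Fin m → Fin d → ℝ) {c : Fin m → RootedTerm d L →₀ ℝ}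
    (hc : ∀ K, network (n := n) hL φ (x K) =
      fun θ => MvPolynomial.eval θ (∑ T ∈ (c K).support, c K T • T.poly n)) :
    S.correlation hL φ x n = ∑ T ∈ Fintype.piFinset fun K => (c K).support,
      (∏ K, c K (T K)) * S.templateCorrelation T n := by
  have hexp : ∀ μ θ, S.tensorProd hL φ x μ θ =
      ∑ T ∈ Fintype.piFinset fun K => (c K).support,
        ∑ σ : (K : Fin m) → Option (T K).Vert → Fin n,
          ((∏ K, c K (T K)) * ∏ K, (√(n : ℝ))⁻¹ ^ (Fintype.card (T K).Vert + 1)) *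
            MvPolynomial.eval θ (∏ K, iterPDeriv (S.rank K) (fun j => μ (S.label ⟨K, j⟩))
              (MvPolynomial.monomial ((T K).exponent (σ K)) 1)) := fun μ θ => by
    rw [S.tensorProd_eq_eval hL φ x hc, map_prod]
    simp only [map_sum, map_smul, MvPolynomial.smul_eval, Finset.prod_univ_sum]
    refine Finset.sum_congr rfl fun T _ => ?_
    simp only [RootedTerm.poly, map_smul, map_sum, MvPolynomial.smul_eval, Finset.mul_sum,
      Finset.prod_univ_sum, Fintype.piFinset_univ, map_prod]
    refine Finset.sum_congr rfl fun σ _ => ?_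
    rw [← Finset.prod_mul_distrib, ← Finset.prod_mul_distrib]
    exact Finset.prod_congr rfl fun K _ => (mul_assoc _ _ _).symm
  have hint : ∀ μ, ∫ θ, S.tensorProd hL φ x μ θ ∂(initLaw d L n) =
      ∑ T ∈ Fintype.piFinset fun K => (c K).support,
        ∑ σ : (K : Fin m) → Option (T K).Vert → Fin n,
          ((∏ K, c K (T K)) * ∏ K, (√(n : ℝ))⁻¹ ^ (Fintype.card (T K).Vert + 1)) *
            S.monomialExpectation (fun K => (T K).exponent (σ K)) μ := fun μ => by
    simp only [hexp]
    have hi : ∀ P : MvPolynomial (Param d L n) ℝ, ∀ a : ℝ,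
        Integrable (fun θ => a * MvPolynomial.eval θ P) (initLaw d L n) := fun P a =>
      (integrable_mvPolynomial_eval P).const_mul a
    rw [integral_finsetSum _ fun T _ => integrable_finsetSum _ fun σ _ => hi _ _]
    refine Finset.sum_congr rfl fun T _ => ?_
    rw [integral_finsetSum _ fun σ _ => hi _ _]
    refine Finset.sum_congr rfl fun σ _ => ?_
    rw [integral_const_mul]
    simp only [map_prod]
    rfl
  simp only [correlation, hint, templateCorrelation]
  rw [Finset.sum_comm]
  refine Finset.sum_congr rfl fun T _ => ?_
  rw [Finset.sum_comm, ← mul_assoc, Finset.mul_sum]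
  exact Finset.sum_congr rfl fun σ _ => (Finset.mul_sum _ _ _).symm

theorem degree_sum_exponent {n : ℕ} (T : Fin m → RootedTerm d L)
    (σ : (K : Fin m) → Option (T K).Vert → Fin n) :
    (∑ K, (T K).exponent (σ K)).degree =
      ∑ K, (1 + (T K).uEdges.card + (T K).wEdges.card) := by
  rw [map_sum]
  refine Finset.sum_congr rfl fun K _ => ?_
  rw [← RootedTerm.card_params (T K) (σ K), ← Multiset.toFinsupp_sum_eq]
  rfl

open Classical in
theorem card_isContributing_le {n : ℕ} (hn : 0 < n) (T : Fin m → RootedTerm d L) :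
    (Finset.univ.filter fun σ : (K : Fin m) → Option (T K).Vert → Fin n =>
      S.IsContributing fun K => (T K).exponent (σ K)).card ≤
      ((∑ K, Fintype.card (T K).Vert + (2 * S.numEven + S.numOdd)) / 2) ^
          Fintype.card (Σ K, Option (T K).Vert) *
        n ^ ((∑ K, Fintype.card (T K).Vert + (2 * S.numEven + S.numOdd)) / 2) := by
  refine le_trans ?_ (card_filter_ncard_range_le hn _)
  refine Finset.card_le_card_of_injOn
    (fun σ (v : Σ K, Option (T K).Vert) => σ v.1 v.2) (fun σ hσ => ?_) (fun σ _ σ' _ h => ?_)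
  · have h := S.two_mul_ncard_range_le T σ (Finset.mem_filter.1 hσ).2
    refine Finset.mem_coe.2 (Finset.mem_filter.2 ⟨Finset.mem_univ _, ?_⟩)
    exact (Nat.le_div_iff_mul_le two_pos).2 (by rwa [mul_comm])
  · funext K a
    exact congrFun h ⟨K, a⟩

/-- The `n ^ N` from counting assignments meets the prefactor `n^{-(v+m)/2}`. Since `2 * N ≤ v + 2 *
numEven + numOdd`, the number `v` of non-root vertices cancels, which is why the exponent is the
same for all templates. -/
theorem abs_templateCorrelation_le (T : Fin m → RootedTerm d L) :
    ∃ C : ℝ, ∀ n : ℕ, 0 < n → |S.templateCorrelation T n| ≤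
      C * (n : ℝ) ^ ((S.numEven : ℝ) + ((S.numOdd : ℝ) - (m : ℝ)) / 2) := by
  classical
  set v := ∑ K, Fintype.card (T K).Vert with hv
  set N := (v + (2 * S.numEven + S.numOdd)) / 2 with hN
  set D := ∑ K, (1 + (T K).uEdges.card + (T K).wEdges.card)
  set q := Fintype.card (Σ K, Option (T K).Vert)
  refine ⟨(N : ℝ) ^ q * S.monomialBound D, fun n hn => ?_⟩
  have hn1 : (1 : ℝ) ≤ n := by exact_mod_cast hn
  have hn0 : (0 : ℝ) < n := by positivity
  have hsum : |∑ σ : (K : Fin m) → Option (T K).Vert → Fin n,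
      ∑ μ, S.monomialExpectation (fun K => (T K).exponent (σ K)) μ| ≤
      ((N : ℝ) ^ q * (n : ℝ) ^ N) * S.monomialBound D := by
    rw [← Finset.sum_filter_of_ne (p := fun σ : (K : Fin m) → Option (T K).Vert → Fin n =>
      S.IsContributing fun K => (T K).exponent (σ K)) (fun σ _ hσ => by
        obtain ⟨μ, -, hμ⟩ := Finset.exists_ne_zero_of_sum_ne_zero hσ
        exact (S.isContributing_of_monomialExpectation_ne_zero hμ).1)]
    refine (Finset.abs_sum_le_sum_abs _ _).trans ?_
    refine (Finset.sum_le_card_nsmul _ _ (S.monomialBound D) fun σ _ =>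
      S.abs_sum_monomialExpectation_le (degree_sum_exponent T σ).le).trans ?_
    rw [nsmul_eq_mul]
    refine mul_le_mul_of_nonneg_right ?_ (S.monomialBound_nonneg D)
    exact_mod_cast S.card_isContributing_le hn T
  have hpre : (∏ K, (√(n : ℝ))⁻¹ ^ (Fintype.card (T K).Vert + 1)) =
      (n : ℝ) ^ (-((v : ℝ) + m) / 2) := by
    rw [Finset.prod_pow_eq_pow_sum, Finset.sum_add_distrib, ← hv, Real.sqrt_eq_rpow,
      ← Real.rpow_neg hn0.le, ← Real.rpow_natCast, ← Real.rpow_mul hn0.le]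
    congr 1
    simp
    ring
  have hpow : (n : ℝ) ^ (-((v : ℝ) + m) / 2) * (n : ℝ) ^ N ≤
      (n : ℝ) ^ ((S.numEven : ℝ) + ((S.numOdd : ℝ) - (m : ℝ)) / 2) := by
    rw [← Real.rpow_natCast, ← Real.rpow_add hn0]
    refine Real.rpow_le_rpow_of_exponent_le hn1 ?_
    have h2 : 2 * N ≤ v + (2 * S.numEven + S.numOdd) := by omega
    have h2' : 2 * (N : ℝ) ≤ v + (2 * S.numEven + S.numOdd) := by exact_mod_cast h2
    linarith
  rw [templateCorrelation, hpre, abs_mul, abs_of_nonneg (by positivity)]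
  calc (n : ℝ) ^ (-((v : ℝ) + m) / 2) * |∑ σ : (K : Fin m) → Option (T K).Vert → Fin n,
        ∑ μ, S.monomialExpectation (fun K => (T K).exponent (σ K)) μ|
      ≤ (n : ℝ) ^ (-((v : ℝ) + m) / 2) * (((N : ℝ) ^ q * (n : ℝ) ^ N) * S.monomialBound D) :=
        mul_le_mul_of_nonneg_left hsum (by positivity)
    _ = ((N : ℝ) ^ q * S.monomialBound D) *
        ((n : ℝ) ^ (-((v : ℝ) + m) / 2) * (n : ℝ) ^ N) := by ring
    _ ≤ _ := mul_le_mul_of_nonneg_left hpow (mul_nonneg (by positivity) (S.monomialBound_nonneg D))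

end IndexStructure

theorem theorem1 {d L m : ℕ} (hL : 0 < L) (φ : Fin L → Polynomial ℝ) (S : IndexStructure m)
    (x : Fin m → Fin d → ℝ) :
    (∀ (n : ℕ) (μ : Fin S.numPairs → Param d L n),
      Integrable (S.tensorProd hL φ x μ) (initLaw d L n)) ∧
    (fun n : ℕ => S.correlation hL φ x n) =O[atTop]
      fun n : ℕ => (n : ℝ) ^ ((S.numEven : ℝ) + ((S.numOdd : ℝ) - (m : ℝ)) / 2) := by
  classical
  refine ⟨fun n μ => S.integrable_tensorProd hL φ x n μ, ?_⟩
  choose c hc using fun K => RootedTerm.exists_network_eq hL φ (x K)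
  have heq : (fun n : ℕ => S.correlation hL φ x n) = fun n =>
      ∑ T ∈ Fintype.piFinset fun K => (c K).support,
        (∏ K, c K (T K)) * S.templateCorrelation T n :=
    funext fun n => S.correlation_eq_sum hL φ x fun K => hc K n
  rw [heq]
  refine IsBigO.fun_sum fun T _ => ?_
  refine IsBigO.const_mul_left ?_ _
  obtain ⟨C, hC⟩ := S.abs_templateCorrelation_le T
  refine IsBigO.of_bound C (eventually_atTop.2 ⟨1, fun n hn => ?_⟩)
  rw [Real.norm_eq_abs, Real.norm_of_nonneg (by positivity)]
  exact hC n hn
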